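/- Let $\mathfrak g$ be a finite-dimensional complex simple Lie algebra with Cartan subalgebra $\mathfrak h$, root set $R$, simple roots $\alpha_i$ ($i\in I$), positive roots $R^+$ and highest root $\theta$. For $\alpha\in R$ let $h_\alpha\in\mathfrak h$ be the coroot, and for $\alpha\in R^+$ fix $x_\alpha^\pm\in\mathfrak g_{\pm\alpha}$ with $[x_\alpha^+,x_\alpha^-]=h_\alpha$, $[h_\alpha,x_\alpha^\pm]=\pm2x_\alpha^\pm$. Write $h_i=h_{\alpha_i}$ and $x_m=x\otimes t^m$. Let $L(\mathfrak g)=\mathfrak g\otimes\mathbb C[t,t^{-1}]$ and $L^e(\mathfrak g)=L(\mathfrak g)\oplus\mathbb Cd$ with $[d,x\otimes t^r]=r\,x\otimes t^r$, and let $\mathbf U$, $\mathbf U^e$ be their universal enveloping algebras. Let $\delta\in(\mathfrak h\oplus\mathbb Cd)^*$ be given by $\delta(\mathfrak h)=0$, $\delta(d)=1$, and extend $\lambda\in\mathfrak h^*$ by $\lambda(d)=0$. Let $\mathbf U(0)\subset\mathbf U$ be the subalgebra generated by the $h_{\alpha,m}$ ($\alpha\in R$, $m\neq0$), and put $$\Lambda_i^\pm(u)=\sum_{m\ge0}\Lambda_{i,\pm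 m}u^m=\exp\Big(-\sum_{k\ge1}\frac{h_{i,\pm k}}{k}u^k\Big),\quad \tilde X_i^-(u)=\sum_{m\in\mathbb Z}x^-_{i,m}u^{m+1},\quad X_{i,0}^-(u)=\sum_{m\ge0}x^-_{i,m}u^{m+1};$$ $(f)_m$ denotes the coefficient of $u^m$ in $f$. For a $\mathbf U^e$-module (resp. $\mathbf U$-module) $V$ let $V_\lambda$ be the $\lambda$-weight space for $\mathfrak h\oplus\mathbb Cd$ (resp. for $\mathfrak h$), and $V_\lambda^+$ the set of $v\in V_\lambda$ with $x_{\beta,m}^+v=0$ for all $\beta\in R^+$, $m\in\mathbb Z$. A $\mathbf U^e$-module $V$ is integrable if it is the direct sum of its weight spaces and the elements $e_i^\pm=x_{\alpha_i}^\pm\otimes1$ ($i\in I$), $e_0^\pm=x_\theta^\mp\otimes t^{\pm1}$ act locally nilpotently on $V$. For $\lambda\in(\mathfrak h\oplus\mathbb Cd)^*$ with all $\lambda(h_i)\in\mathbb Z_{\ge0}$ let $\tilde I_\lambda$ be the left ideal of $\mathbf U$ generated by * $h-\lambda(h)$ ($h\in\mathfrak h$); $x^+_{i,m}$ ($i\in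 I$, $m\in\mathbb Z$); $\Lambda_{i,m}$ ($|m|>\lambda(h_i)$); * $\Lambda_{i,\lambda(h_i)}\Lambda_{i,-m}-\Lambda_{i,\lambda(h_i)-m}$ ($1\le m\le\lambda(h_i)$); * $\big(\tilde X_i^-(u)\Lambda_i^+(u)\big)_m\,y$ ($m\in\mathbb Z$, $y\in\mathbf U(0)$), where $\Lambda_i^+(u)$ is truncated to $\sum_{k=0}^{\lambda(h_i)}\Lambda_{i,k}u^k$; * $\big(X_{i,0}^-(u)^r\Lambda_i^+(u)\big)_m\,y$ ($r\ge1$, $m>\lambda(h_i)$, $y\in\mathbf U(0)$). Let $\tilde I_\lambda^e$ be the left ideal of $\mathbf U^e$ generated by $\tilde I_\lambda$ and $d-\lambda(d)$. Define $W(\lambda)$ to be $\mathbf U^e/\tilde I^e_\lambda$ as a $\mathbf U^e$-module and $\mathbf U/\tilde I_\lambda$ as a $\mathbf U$-module, and let $w_\lambda$ be the class of $1$. For a tuple $\pi=(\pi_i)_{i\in I}$ of complex polynomials with constant term $1$ let $\lambda_\pi(h_i)=\deg\pi_i$, let $\pi_i^+=\pi_i$, and let $\pi_i^-(u)$ be $u^{\deg\pi_i}\pi_i(u^{-1})$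 divided by its constant term. Let $I_\pi(0)$ be the ideal of $\mathbf U(0)$ generated by the $(\Lambda_i^\pm(u)-\pi_i^\pm(u))_s$ ($i\in I$, $s\ge0$). With $\mathbf U(0)$ acting on $W(\lambda_\pi)=\mathbf U/\tilde I_{\lambda_\pi}$ by right multiplication, put $$W(\pi)=W(\lambda_\pi)\otimes_{\mathbf U(0)}\mathbf U(0)/I_\pi(0)=W(\lambda_\pi)/W(\lambda_\pi)I_\pi(0),$$ and let $w_\pi$ be the image of $w_{\lambda_\pi}$. **Proposition.** (i) Let $V$ be an integrable $\mathbf U^e$-module generated by a non-zero element $v\in V_\lambda^+$, where $\lambda\in(\mathfrak h\oplus\mathbb Cd)^*$. Then $\lambda(h_i)\in\mathbb Z_{\ge0}$ for all $i\in I$, and $V$ is a quotient of the $\mathbf U^e$-module $W(\lambda)$, by a homomorphism with $w_\lambda\mapsto v$. (ii) Let $\lambda\in\mathfrak h^*$ with $\lambda(h_i)\in\mathbb Z_{\ge0}$ for all $i\in I$, and let $V$ be a finite-dimensional quotient of the $\mathbf U$-module $W(\lambda)$ with $\dim V_\lambda=1$. Then there is a tuple $\pi$ of polynomials with constant term $1$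 such that $V$ is a quotient of the $\mathbf U$-module $W(\pi)$, by a homomorphism sending $w_\pi$ to the image of $w_\lambda$. (iii) Let $V$ be a finite-dimensional $\mathbf U$-module generated by a vector $v\in V_\lambda^+$, where $\lambda\in\mathfrak h^*$, and assume that $\dim V_\lambda=1$. Then there is a tuple $\pi$ of polynomials with constant term $1$ such that $V$ is a quotient of the $\mathbf U$-module $W(\pi)$, by a homomorphism with $w_\pi\mapsto v$. -/

import Mathlib

open scoped TensorProduct PowerSeries

noncomputable section

namespace LoopWeyl

attribute [local instance 100] LieRing.ofAssociativeRing

/-! ### The loop algebra and the extended loop algebra -/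

section Loop

variable (𝔤 : Type*) [LieRing 𝔤] [LieAlgebra ℂ 𝔤]

/-- The loop algebra `L(𝔤) = 𝔤 ⊗ ℂ[t, t⁻¹]` (the Laurent polynomial factor is written first). -/
abbrev Loop := LieAlgebra.loopAlgebra ℂ ℤ 𝔤

variable {𝔤} in
/-- The element `x ⊗ t ^ m` of the loop algebra. -/
def tmul (x : 𝔤) (m : ℤ) : Loop 𝔤 := AddMonoidAlgebra.single m (1 : ℂ) ⊗ₜ[ℂ] x

/-- The linear map `t ^ m ↦ m t ^ m` of `ℂ[t, t⁻¹]`. -/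
def degMap : AddMonoidAlgebra ℂ ℤ →ₗ[ℂ] AddMonoidAlgebra ℂ ℤ :=
  (AddMonoidAlgebra.basis ℤ ℂ).constr ℂ fun m => (m : ℂ) • AddMonoidAlgebra.single m (1 : ℂ)

theorem degMap_single (m : ℤ) :
    degMap (AddMonoidAlgebra.single m (1 : ℂ)) = (m : ℂ) • AddMonoidAlgebra.single m (1 : ℂ) := by
  have h := (AddMonoidAlgebra.basis ℤ ℂ).constr_basis ℂ
    (fun m : ℤ => (m : ℂ) • (AddMonoidAlgebra.single m (1 : ℂ) : AddMonoidAlgebra ℂ ℤ)) m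
  simpa [degMap] using h

theorem degMap_mul (p q : AddMonoidAlgebra ℂ ℤ) :
    degMap (p * q) = p * degMap q + q * degMap p := by
  induction p using AddMonoidAlgebra.induction_linear with
  | zero => simp
  | add p p' hp hp' => simp only [add_mul, map_add, mul_add, hp, hp']; abel
  | single m c =>
    induction q using AddMonoidAlgebra.induction_linear with
    | zero => simp
    | add q q' hq hq' => simp only [add_mul, map_add, mul_add, hq, hq']; abel
    | single k e =>
      have key : ∀ (n : ℤ) (z : ℂ), degMap (AddMonoidAlgebra.single n z)
          = AddMonoidAlgebra.single n ((n : ℂ) * z) := fun n z => by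
        have h1 : (AddMonoidAlgebra.single n z : AddMonoidAlgebra ℂ ℤ)
            = z • AddMonoidAlgebra.single n (1 : ℂ) := by
          rw [AddMonoidAlgebra.smul_single, smul_eq_mul, mul_one]
        rw [h1, map_smul, degMap_single, smul_smul, AddMonoidAlgebra.smul_single, smul_eq_mul,
          mul_one, mul_comm]
      rw [AddMonoidAlgebra.single_mul_single, key, key, key, AddMonoidAlgebra.single_mul_single,
        AddMonoidAlgebra.single_mul_single, add_comm k m, ← AddMonoidAlgebra.single_add]
      congr 1
      push_cast
      ring

/-- The derivation `t d/dt` of the loop algebra: `x ⊗ t ^ m ↦ m (x ⊗ t ^ m)`. -/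
def degDer : LieDerivation ℂ (Loop 𝔤) (Loop 𝔤) where
  toLinearMap := degMap.rTensor 𝔤
  leibniz' a b := by
    induction a using TensorProduct.induction_on with
    | zero => simp
    | add x y hx hy => simp only [add_lie, lie_add, map_add, hx, hy]; abel
    | tmul p x =>
      induction b using TensorProduct.induction_on with
      | zero => simp
      | add x y hx hy => simp only [add_lie, lie_add, map_add, hx, hy]; abel
      | tmul q y =>
        simp only [LieAlgebra.ExtendScalars.bracket_tmul, LinearMap.rTensor_tmul, degMap_mul,
          TensorProduct.add_tmul]
        rw [← lie_skew x y, TensorProduct.tmul_neg, TensorProduct.tmul_neg, sub_eq_add_neg]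

/-- The action of the one-dimensional Lie algebra `ℂ d` on the loop algebra. -/
def degAction : ℂ →ₗ⁅ℂ⁆ LieDerivation ℂ (Loop 𝔤) (Loop 𝔤) where
  toFun c := c • degDer 𝔤
  map_add' a b := add_smul a b _
  map_smul' a b := by simp [mul_smul]
  map_lie' {a b} := by simp [LieRing.of_associative_ring_bracket, mul_comm]

/-- The extended loop algebra `Lᵉ(𝔤) = L(𝔤) ⊕ ℂ d`, in which `[d, x ⊗ t ^ r] = r (x ⊗ t ^ r)`. -/
abbrev ExtLoop := LieAlgebra.SemiDirectSum (Loop 𝔤) ℂ (degAction 𝔤)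

/-- The universal enveloping algebra `U` of the loop algebra. -/
abbrev U := UniversalEnvelopingAlgebra ℂ (Loop 𝔤)

/-- The universal enveloping algebra `Uᵉ` of the extended loop algebra. -/
abbrev Ue := UniversalEnvelopingAlgebra ℂ (ExtLoop 𝔤)

/-- The algebra homomorphism `U → Uᵉ` induced by the inclusion `L(𝔤) ⊆ Lᵉ(𝔤)`. -/
def toUe : U 𝔤 →ₐ[ℂ] Ue 𝔤 :=
  UniversalEnvelopingAlgebra.lift ℂ
    ((UniversalEnvelopingAlgebra.ι ℂ : ExtLoop 𝔤 →ₗ⁅ℂ⁆ Ue 𝔤).comp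
      (LieAlgebra.SemiDirectSum.inl (degAction 𝔤)))

/-- The element `d` of `Uᵉ`. -/
def dElt : Ue 𝔤 := UniversalEnvelopingAlgebra.ι ℂ (LieAlgebra.SemiDirectSum.inr (degAction 𝔤) 1)

variable {𝔤} in
/-- The element `x_m = x ⊗ t ^ m` of `U`. -/
def el (x : 𝔤) (m : ℤ) : U 𝔤 := UniversalEnvelopingAlgebra.ι ℂ (tmul x m)

end Loop

/-! ### The data fixed on the simple Lie algebra -/

section Main

open LieAlgebra.IsKilling

variable {𝔤 : Type*} [LieRing 𝔤] [LieAlgebra ℂ 𝔤] [FiniteDimensional ℂ 𝔤]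
  [LieAlgebra.IsSimple ℂ 𝔤] {𝔥 : LieSubalgebra ℂ 𝔤} [𝔥.IsCartanSubalgebra]

variable (𝔥) in
/-- The choices made once and for all: a set of simple roots of the root system of `(𝔤, 𝔥)` and,
for each positive root `α`, root vectors `x⁺_α ∈ 𝔤_α`, `x⁻_α ∈ 𝔤_{-α}` with
`[x⁺_α, x⁻_α] = h_α` (the coroot) and `[h_α, x^±_α] = ± 2 x^±_α`. -/
structure ChevalleyData where
  /-- the simple roots -/
  base : (rootSystem 𝔥).Base
  /-- the vectors `x⁺_α` -/
  xp : {α : 𝔥.root // base.IsPos α} → 𝔤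
  /-- the vectors `x⁻_α` -/
  xm : {α : 𝔥.root // base.IsPos α} → 𝔤
  xp_mem : ∀ α, xp α ∈ LieAlgebra.rootSpace 𝔥 (α.1.1 : 𝔥 → ℂ)
  xm_mem : ∀ α, xm α ∈ LieAlgebra.rootSpace 𝔥 (-(α.1.1 : 𝔥 → ℂ))
  sl2 : ∀ α, IsSl2Triple ((rootSystem 𝔥).coroot α.1 : 𝔤) (xp α) (xm α)

namespace ChevalleyData

variable (D : ChevalleyData 𝔥)

/-- The index set `I` of the simple roots. -/
abbrev I := {i : 𝔥.root // i ∈ D.base.support}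

/-- The set `R⁺` of positive roots. -/
abbrev Pos := {α : 𝔥.root // D.base.IsPos α}

/-- A simple root, as a positive root. -/
def pos (i : D.I) : D.Pos := ⟨i.1, RootPairing.Base.isPos_of_mem_support i.2⟩

/-- The highest root: `θ - β` is a sum of simple roots, for every root `β`. -/
def IsHighestRoot (θ : D.Pos) : Prop :=
  ∀ β : 𝔥.root, (rootSystem 𝔥).root θ.1 - (rootSystem 𝔥).root β ∈
    AddSubmonoid.closure ((rootSystem 𝔥).root '' D.base.support)

/-- The dominant integral weight `∑ i, ℓ i • ω i ∈ P₊`, that is, the linear form on `𝔥`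
with value `ℓ i` at the simple coroot `h i`, for each `i ∈ I`. -/
def domWeight (ℓ : D.I → ℕ) : Module.Dual ℂ 𝔥 :=
  D.base.toCoweightBasis.constr ℂ fun i => (ℓ i : ℂ)

/-- `x⁺_{i,m} = x⁺_{α_i} ⊗ t ^ m`. -/
def xP (i : D.I) (m : ℤ) : U 𝔤 := el (D.xp (D.pos i)) m

/-- `x⁻_{i,m} = x⁻_{α_i} ⊗ t ^ m`. -/
def xM (i : D.I) (m : ℤ) : U 𝔤 := el (D.xm (D.pos i)) m

/-- `h_{i,m} = h_i ⊗ t ^ m`. -/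
def hh (i : D.I) (m : ℤ) : U 𝔤 := el ((rootSystem 𝔥).coroot i.1 : 𝔤) m

end ChevalleyData

/-! ### Generating series -/

/-- The power series `exp (-∑_{k ≥ 1} (h k / k) u ^ k)`. Since `f = -∑_{k ≥ 1} (h k / k) u ^ k` has
no constant term, the coefficient of `u ^ m` in `exp f = ∑ n, f ^ n / n!` is the finite sum
below. -/
def expSeries {A : Type*} [Ring A] [Algebra ℂ A] (h : ℕ → A) : A⟦X⟧ :=
  let f : A⟦X⟧ := PowerSeries.mk fun k => if k = 0 then 0 else -((k : ℂ)⁻¹ • h k)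
  PowerSeries.mk fun m =>
    ∑ n ∈ Finset.range (m + 1), ((n.factorial : ℂ)⁻¹) • PowerSeries.coeff m (f ^ n)

namespace ChevalleyData

variable (D : ChevalleyData 𝔥)

/-- `Λ_i⁺(u) = ∑_{m ≥ 0} Λ_{i,m} u ^ m = exp (-∑_{k ≥ 1} (h_{i,k} / k) u ^ k)`. -/
def LamP (i : D.I) : (U 𝔤)⟦X⟧ := expSeries fun k => D.hh i k

/-- `Λ_i⁻(u) = ∑_{m ≥ 0} Λ_{i,-m} u ^ m = exp (-∑_{k ≥ 1} (h_{i,-k} / k) u ^ k)`. -/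
def LamM (i : D.I) : (U 𝔤)⟦X⟧ := expSeries fun k => D.hh i (-k)

/-- `Λ_{i,m}` for `m ≥ 0`. -/
def lamP (i : D.I) (m : ℕ) : U 𝔤 := PowerSeries.coeff m (D.LamP i)

/-- `Λ_{i,-m}` for `m ≥ 0`. -/
def lamM (i : D.I) (m : ℕ) : U 𝔤 := PowerSeries.coeff m (D.LamM i)

/-- `X⁻_{i,0}(u) = ∑_{m ≥ 0} x⁻_{i,m} u ^ (m + 1)`. -/
def XM0 (i : D.I) : (U 𝔤)⟦X⟧ := PowerSeries.X * PowerSeries.mk fun m => D.xM i m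

end ChevalleyData

variable (𝔥) in
/-- The subalgebra `U(0)` of `U`, generated by the `h_{α,m}` with `α ∈ R` and `m ≠ 0`. -/
def U0 : Subalgebra ℂ (U 𝔤) :=
  Algebra.adjoin ℂ {y | ∃ (α : 𝔥.root) (m : ℤ), m ≠ 0 ∧ y = el ((rootSystem 𝔥).coroot α : 𝔤) m}

/-! ### The modules `W(λ)` and `W(π)` -/

namespace ChevalleyData

variable (D : ChevalleyData 𝔥)

/-- The generators of the left ideal defining `W(λ)`, where `λ(h_i) = ℓ i`. Modulo the
`Λ_{i,k}` with `k > ℓ i` (which commute with `U(0)`), the coefficient of `u ^ m` in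
`(∑_{k ∈ ℤ} x⁻_{i,k} u ^ (k + 1)) Λ_i⁺(u)` is the finite sum in `current`. The coefficient of `u ^ m`
in `X⁻_{i,0}(u) ^ r Λ_i⁺(u)` is zero for `m < 0`. -/
inductive Rel (ℓ : D.I → ℕ) : U 𝔤 → Prop
  | weight (h : 𝔥) : Rel ℓ (el (h : 𝔤) 0 - algebraMap ℂ (U 𝔤) (D.domWeight ℓ h))
  | lam_pos (i : D.I) (m : ℕ) (hm : ℓ i < m) : Rel ℓ (D.lamP i m)
  | lam_neg (i : D.I) (m : ℕ) (hm : ℓ i < m) : Rel ℓ (D.lamM i m)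
  | lam_mul (i : D.I) (m : ℕ) (h1 : 1 ≤ m) (hm : m ≤ ℓ i) :
      Rel ℓ (D.lamP i (ℓ i) * D.lamM i m - D.lamP i (ℓ i - m))
  | current (i : D.I) (m : ℤ) (y : U 𝔤) (hy : y ∈ U0 𝔥) :
      Rel ℓ ((∑ k ∈ Finset.range (ℓ i + 1), D.xM i (m - 1 - k) * D.lamP i k) * y)
  | garland (i : D.I) (r m : ℕ) (hr : 1 ≤ r) (hm : ℓ i < m) (y : U 𝔤) (hy : y ∈ U0 𝔥) :
      Rel ℓ (PowerSeries.coeff m (D.XM0 i ^ r * D.LamP i) * y)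
  | raising (i : D.I) (m : ℤ) : Rel ℓ (D.xP i m)

/-- The left ideal `Ĩ_λ` of `U`, for `λ = ∑ i, ℓ i • ω i`. -/
def weylIdeal (ℓ : D.I → ℕ) : Submodule (U 𝔤) (U 𝔤) := Submodule.span (U 𝔤) {y | D.Rel ℓ y}

/-- The left ideal `Ĩᵉ_λ` of `Uᵉ`, for `λ = ∑ i, ℓ i • ω i + a δ`: it is generated by `Ĩ_λ`
and `d - λ(d)`. -/
def weylIdealExt (ℓ : D.I → ℕ) (a : ℂ) : Submodule (Ue 𝔤) (Ue 𝔤) :=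
  Submodule.span (Ue 𝔤) (toUe 𝔤 '' (D.weylIdeal ℓ) ∪ {dElt 𝔤 - algebraMap ℂ (Ue 𝔤) a})

/-- The `U`-module `W(λ) = U / Ĩ_λ`, for `λ = ∑ i, ℓ i • ω i`. -/
abbrev Weyl (ℓ : D.I → ℕ) := U 𝔤 ⧸ D.weylIdeal ℓ

/-- The generator `w_λ` of the `U`-module `W(λ)`. -/
def weylGen (ℓ : D.I → ℕ) : D.Weyl ℓ := Submodule.Quotient.mk 1

/-- The `Uᵉ`-module `W(λ) = Uᵉ / Ĩᵉ_λ`, for `λ = ∑ i, ℓ i • ω i + a δ`. -/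
abbrev WeylExt (ℓ : D.I → ℕ) (a : ℂ) := Ue 𝔤 ⧸ D.weylIdealExt ℓ a

/-- The generator `w_λ` of the `Uᵉ`-module `W(λ)`. -/
def weylExtGen (ℓ : D.I → ℕ) (a : ℂ) : D.WeylExt ℓ a := Submodule.Quotient.mk 1

end ChevalleyData

/-- The polynomial `π⁻(u) = u ^ deg π * π(u⁻¹)`, normalised to have constant term `1`. -/
def revPoly (p : Polynomial ℂ) : Polynomial ℂ :=
  Polynomial.C (p.reverse.coeff 0)⁻¹ * p.reverse

namespace ChevalleyData

variable (D : ChevalleyData 𝔥)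

/-- The elements `(Λ_i^±(u) - π_i^±(u))_s` generating the ideal `I_π(0)` of `U(0)`. -/
inductive RelPi (p : D.I → Polynomial ℂ) : U 𝔤 → Prop
  | pos (i : D.I) (s : ℕ) : RelPi p (D.lamP i s - algebraMap ℂ (U 𝔤) ((p i).coeff s))
  | neg (i : D.I) (s : ℕ) : RelPi p (D.lamM i s - algebraMap ℂ (U 𝔤) ((revPoly (p i)).coeff s))

/-- The tuple `(deg π_i)`, i.e. the coordinates of the weight `λ_π` with `λ_π(h_i) = deg π_i`. -/
def degs (p : D.I → Polynomial ℂ) : D.I → ℕ := fun i => (p i).natDegree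

/-- The submodule `W(λ_π) I_π(0)` of `W(λ_π)`, where `U(0)` acts on the right on `W(λ_π) = U / Ĩ`
by right multiplication: it is spanned over `U` by the classes `w_λ · g` of the generators `g` of
the ideal `I_π(0)`. -/
def weylPiSub (p : D.I → Polynomial ℂ) : Submodule (U 𝔤) (D.Weyl (D.degs p)) :=
  Submodule.span (U 𝔤) (Submodule.Quotient.mk '' {y | D.RelPi p y})

/-- The `U`-module `W(π) = W(λ_π) ⊗_{U(0)} ℂ_π`, where `ℂ_π = U(0) / I_π(0)`. The tensor product
of a module with `U(0) / I_π(0)` is the quotient `W(λ_π) / W(λ_π) I_π(0)`. -/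
abbrev WeylPi (p : D.I → Polynomial ℂ) := D.Weyl (D.degs p) ⧸ D.weylPiSub p

/-- The generator `w_π` of `W(π)`. -/
def weylPiGen (p : D.I → Polynomial ℂ) : D.WeylPi p :=
  Submodule.Quotient.mk (D.weylGen (D.degs p))

end ChevalleyData

/-! ### Weight spaces and integrable modules -/

section Modules

/-- The weight space `V_λ` of a `U`-module, for `λ ∈ 𝔥*`. -/
def weightSpace (V : Type*) [AddCommGroup V] [Module ℂ V] [Module (U 𝔤) V]
    [IsScalarTower ℂ (U 𝔤) V] (lam : Module.Dual ℂ 𝔥) : Submodule ℂ V where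
  carrier := {v | ∀ h : 𝔥, el (h : 𝔤) 0 • v = lam h • v}
  add_mem' hv hw h := by rw [smul_add, smul_add, hv h, hw h]
  zero_mem' h := by rw [smul_zero, smul_zero]
  smul_mem' c v hv h := by
    rw [← algebraMap_smul (U 𝔤) c v, ← mul_smul, ← Algebra.commutes, mul_smul, hv h,
      algebraMap_smul, algebraMap_smul, smul_comm]

/-- The weight space `V_{λ + a δ}` of a `Uᵉ`-module, for `λ ∈ 𝔥*` and `a ∈ ℂ`. Every linear form
on `𝔥 ⊕ ℂ d` is `λ + a δ` for a unique pair `(λ, a)`. -/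
def weightSpaceExt (V : Type*) [AddCommGroup V] [Module ℂ V] [Module (Ue 𝔤) V]
    [IsScalarTower ℂ (Ue 𝔤) V] (lam : Module.Dual ℂ 𝔥) (a : ℂ) : Submodule ℂ V where
  carrier := {v | (∀ h : 𝔥, toUe 𝔤 (el (h : 𝔤) 0) • v = lam h • v) ∧ dElt 𝔤 • v = a • v}
  add_mem' hv hw :=
    ⟨fun h => by rw [smul_add, smul_add, hv.1 h, hw.1 h], by rw [smul_add, smul_add, hv.2, hw.2]⟩
  zero_mem' := ⟨fun h => by rw [smul_zero, smul_zero], by rw [smul_zero, smul_zero]⟩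
  smul_mem' c v hv := by
    refine ⟨fun h => ?_, ?_⟩
    · rw [← algebraMap_smul (Ue 𝔤) c v, ← mul_smul, ← Algebra.commutes, mul_smul, hv.1 h,
        algebraMap_smul, algebraMap_smul, smul_comm]
    · rw [← algebraMap_smul (Ue 𝔤) c v, ← mul_smul, ← Algebra.commutes, mul_smul, hv.2,
        algebraMap_smul, algebraMap_smul, smul_comm]

namespace ChevalleyData

variable (D : ChevalleyData 𝔥)

/-- The set `V_λ⁺` of a `U`-module: the `v ∈ V_λ` with `x⁺_{β,m} v = 0` for all `β ∈ R⁺`, `m ∈ ℤ`. -/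
def highestWeightVectors (V : Type*) [AddCommGroup V] [Module ℂ V] [Module (U 𝔤) V]
    [IsScalarTower ℂ (U 𝔤) V] (lam : Module.Dual ℂ 𝔥) : Set V :=
  {v | v ∈ weightSpace V lam ∧ ∀ (β : D.Pos) (m : ℤ), el (D.xp β) m • v = 0}

/-- The set `V_{λ + a δ}⁺` of a `Uᵉ`-module. -/
def highestWeightVectorsExt (V : Type*) [AddCommGroup V] [Module ℂ V] [Module (Ue 𝔤) V]
    [IsScalarTower ℂ (Ue 𝔤) V] (lam : Module.Dual ℂ 𝔥) (a : ℂ) : Set V :=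
  {v | v ∈ weightSpaceExt V lam a ∧
    ∀ (β : D.Pos) (m : ℤ), toUe 𝔤 (el (D.xp β) m) • v = 0}

/-- Integrable `Uᵉ`-modules: the Chevalley generators `e_i^± = x^±_i ⊗ 1` (`i ∈ I`) and
`e_0^± = x^∓_θ ⊗ t^{±1}` (`θ` the highest root) act locally nilpotently, and the module is the sum of
its weight spaces (such a sum is always direct). -/
structure IsIntegrable (V : Type*) [AddCommGroup V] [Module ℂ V] [Module (Ue 𝔤) V]
    [IsScalarTower ℂ (Ue 𝔤) V] : Prop where
  e_pos : ∀ (i : D.I) (v : V), ∃ n : ℕ, toUe 𝔤 (D.xP i 0) ^ n • v = 0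
  e_neg : ∀ (i : D.I) (v : V), ∃ n : ℕ, toUe 𝔤 (D.xM i 0) ^ n • v = 0
  e_zero_pos : ∀ θ : D.Pos, D.IsHighestRoot θ → ∀ v : V, ∃ n : ℕ,
    toUe 𝔤 (el (D.xm θ) 1) ^ n • v = 0
  e_zero_neg : ∀ θ : D.Pos, D.IsHighestRoot θ → ∀ v : V, ∃ n : ℕ,
    toUe 𝔤 (el (D.xp θ) (-1)) ^ n • v = 0
  iSup_weightSpace : ⨆ (lam : Module.Dual ℂ 𝔥) (a : ℂ), weightSpaceExt V lam a = ⊤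

end ChevalleyData

end Modules

end Main

end LoopWeyl

end

noncomputable section

namespace LoopWeyl

attribute [local instance 100] LieRing.ofAssociativeRing

/-! ### The Euler operator on power series over a noncommutative ring -/

section Euler

variable {A : Type*} [Ring A]

/-! Everything rests on one fact: if the `x⁻_{i,0}` act nilpotently on the highest weight vectors of
weight `λ`, then such a vector `w` satisfies the defining relations of `W(λ)` (`rel_smul_eq_zero`).
Since `U(0)` preserves highest weight vectors, a factor `y ∈ U(0)` merely replaces `w` by another
one. Apart from the weight relations, each relation involves one simple root, so the work takes
place in the loop algebra of `sl₂`, with families `e`, `f`, `h`.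

Write `F = ∑ f_m u^(m+1)` over `m ≥ 0` and `Λ = exp(-∑ h_k u^k / k)`. Garland's argument is the
identity `e_1 · (F^(r+1) Λ)_m w = -(r+1)(m-r) (F^r Λ)_m w`. At `r = m` the coefficient is `f_0^m`,
which kills `w` once `m > ℓ`; descending in `r` kills `(F^r Λ)_m w` for all `r ≤ m`. The case `r =
0` bounds the degree of `Λ`. The case `r = 1`, translated by the `h_s`, gives the two-sided current
relation. Applying `e_0` to the latter and comparing with Newton's recursion gives `Λ_ℓ Λ_{-j} w =
Λ_{ℓ-j} w`.

For a one-dimensional `V_λ`, the algebra `U(0)` acts on it by scalars, and these relations say that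
the scalars are the coefficients of polynomials `π_i` of degree `λ(h_i)` and of their normalised
reversals (`exists_polynomials`). In (iii), nilpotency comes from finite dimension, which reduces
the statement to the situation of (ii). -/

/-- The operator `u d/du` on power series over a ring that need not be commutative. -/
def euler (f : A⟦X⟧) : A⟦X⟧ := PowerSeries.mk fun n => n • PowerSeries.coeff n f

@[simp] theorem coeff_euler (n : ℕ) (f : A⟦X⟧) :
    PowerSeries.coeff n (euler f) = n • PowerSeries.coeff n f := by simp [euler]

theorem euler_mul (f g : A⟦X⟧) : euler (f * g) = euler f * g + f * euler g := by
  ext n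
  simp only [coeff_euler, PowerSeries.coeff_mul, map_add, Finset.smul_sum,
    ← Finset.sum_add_distrib]
  refine Finset.sum_congr rfl fun p hp => ?_
  rw [Finset.HasAntidiagonal.mem_antidiagonal] at hp
  rw [← hp, add_smul, smul_mul_assoc, mul_smul_comm]

@[simp] theorem euler_one : euler (1 : A⟦X⟧) = 0 := by
  ext n
  rcases n with _ | n <;> simp [PowerSeries.coeff_one]

theorem euler_pow_succ {f : A⟦X⟧} (h : Commute f (euler f)) (n : ℕ) :
    euler (f ^ (n + 1)) = (n + 1) • (f ^ n * euler f) := by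
  induction n with
  | zero => simp
  | succ n ih =>
    rw [pow_succ, euler_mul, ih, smul_mul_assoc, mul_assoc, ← h.eq, ← mul_assoc, ← pow_succ,
      ← succ_nsmul]

theorem commute_of_coeff {f g : A⟦X⟧}
    (h : ∀ i j, Commute (PowerSeries.coeff i f) (PowerSeries.coeff j g)) : Commute f g := by
  ext n
  rw [PowerSeries.coeff_mul, PowerSeries.coeff_mul, ← Finset.Nat.sum_antidiagonal_swap]
  exact Finset.sum_congr rfl fun p _ => (h _ _).eq

theorem coeff_pow_eq_zero {f : A⟦X⟧} (h : PowerSeries.coeff 0 f = 0) {n m : ℕ} (hm : m < n) :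
    PowerSeries.coeff m (f ^ n) = 0 := by
  induction n generalizing m with
  | zero => omega
  | succ n ih =>
    rw [pow_succ, PowerSeries.coeff_mul]
    refine Finset.sum_eq_zero fun p hp => ?_
    rw [Finset.HasAntidiagonal.mem_antidiagonal] at hp
    rcases lt_or_ge p.1 n with h1 | h1
    · rw [ih h1, zero_mul]
    · rw [show p.2 = 0 by omega, h, mul_zero]

end Euler

/-! ### Exponential series and Newton's recursion -/

section Exp

variable {A : Type*} [Ring A] [Algebra ℂ A] (h : ℕ → A)

/-- The series `∑_{k ≥ 1} h k u ^ k`. -/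
def posSeries {A : Type*} [Ring A] (h : ℕ → A) : A⟦X⟧ :=
  PowerSeries.mk fun k => if k = 0 then 0 else h k

@[simp] theorem coeff_zero_expSeries : PowerSeries.coeff 0 (expSeries h) = 1 := by
  simp [expSeries]

/-- The exponent `f` commutes with its Euler derivative, so `exp f` satisfies the usual equation
`E(exp f) = (E f) exp f`. All later work with `expSeries` uses this equation instead of the defining
sum. -/
theorem euler_expSeries (hc : ∀ j k, Commute (h j) (h k)) :
    euler (expSeries h) = -(posSeries h * expSeries h) := by
  set f : A⟦X⟧ := PowerSeries.mk fun k => if k = 0 then 0 else -((k : ℂ)⁻¹ • h k) with hf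
  have hE : ∀ m, PowerSeries.coeff m (expSeries h) = ∑ n ∈ Finset.range (m + 1),
      ((n.factorial : ℂ)⁻¹) • PowerSeries.coeff m (f ^ n) := fun m => by simp [expSeries, hf]
  have hf0 : PowerSeries.coeff 0 f = 0 := by simp [hf]
  have hD : euler f = -posSeries h := by
    ext k
    rcases eq_or_ne k 0 with rfl | hk
    · simp [posSeries]
    · have hk' : (k : ℂ) ≠ 0 := by exact_mod_cast hk
      simp only [coeff_euler, hf, posSeries, PowerSeries.coeff_mk, hk, if_false, map_neg, smul_neg]
      rw [← Nat.cast_smul_eq_nsmul ℂ, smul_smul, mul_inv_cancel₀ hk', one_smul]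
  have hcomm : Commute f (euler f) := by
    rw [hD]
    refine (commute_of_coeff fun i j => ?_).neg_right
    simp only [hf, posSeries, PowerSeries.coeff_mk]
    split_ifs <;> simp [((hc i j).smul_left _).neg_left]
  rw [← neg_mul, ← hD]
  ext m
  rw [coeff_euler, hE, Finset.sum_range_succ', smul_add, PowerSeries.coeff_mul]
  have h0 : m • (((Nat.factorial 0 : ℂ)⁻¹) • PowerSeries.coeff m (f ^ 0)) = 0 := by
    have := congrArg (PowerSeries.coeff m) (euler_one (A := A))
    rw [coeff_euler] at this
    simpa using this
  -- Since `euler f` has no constant term, only `p.2 < m` matters. There the truncation in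
  -- `expSeries` can be lengthened to the common range `n < m`, because `f ^ n` starts in degree
  -- `n`.
  have h1 : ∀ p ∈ Finset.HasAntidiagonal.antidiagonal m, PowerSeries.coeff p.1 (euler f) *
      PowerSeries.coeff p.2 (expSeries h) = ∑ n ∈ Finset.range m, ((n.factorial : ℂ)⁻¹) •
        (PowerSeries.coeff p.1 (euler f) * PowerSeries.coeff p.2 (f ^ n)) := by
    intro p hp
    rw [Finset.HasAntidiagonal.mem_antidiagonal] at hp
    rcases eq_or_ne p.1 0 with h1 | h1
    · simp [h1, hf0]
    · rw [hE, Finset.mul_sum]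
      simp only [mul_smul_comm]
      refine Finset.sum_subset (by intro x; simp; omega) fun n _ hn => ?_
      rw [coeff_pow_eq_zero hf0 (by simpa using hn), mul_zero, smul_zero]
  rw [h0, add_zero, Finset.sum_congr rfl h1, Finset.sum_comm, Finset.smul_sum]
  refine Finset.sum_congr rfl fun n _ => ?_
  rw [← Finset.smul_sum, ← PowerSeries.coeff_mul, smul_comm, ← coeff_euler, euler_pow_succ hcomm,
    ← (hcomm.pow_left n).eq, map_nsmul, ← Nat.cast_smul_eq_nsmul ℂ, smul_smul,
    Nat.factorial_succ]
  congr 1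
  have : (n : ℂ) + 1 ≠ 0 := by exact_mod_cast Nat.succ_ne_zero n
  push_cast
  field_simp

/-- Newton's recursion for the coefficients of `exp (-∑_{k ≥ 1} (h k / k) u ^ k)`. -/
theorem nsmul_coeff_expSeries (hc : ∀ j k, Commute (h j) (h k)) (n : ℕ) :
    n • PowerSeries.coeff n (expSeries h) =
      -∑ k ∈ Finset.range n, h (n - k) * PowerSeries.coeff k (expSeries h) := by
  rw [← coeff_euler, euler_expSeries h hc, map_neg, PowerSeries.coeff_mul,
    ← Finset.Nat.sum_antidiagonal_swap, Finset.Nat.sum_antidiagonal_eq_sum_range_succ_mk,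
    Finset.sum_range_succ]
  simp only [Prod.fst_swap, Prod.snd_swap, posSeries, PowerSeries.coeff_mk, Nat.sub_self, if_true,
    zero_mul, add_zero]
  congr 1
  refine Finset.sum_congr rfl fun k hk => ?_
  rw [if_neg (by simp at hk; omega)]

/-- The coefficients of `expSeries h` lie in every subalgebra containing the `h k`, `k ≥ 1`. -/
theorem coeff_expSeries_mem (hc : ∀ j k, Commute (h j) (h k)) (S : Subalgebra ℂ A)
    (hS : ∀ k, 1 ≤ k → h k ∈ S) (n : ℕ) : PowerSeries.coeff n (expSeries h) ∈ S := by
  induction n using Nat.strong_induction_on with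
  | _ n ih =>
    rcases eq_or_ne n 0 with rfl | hn
    · simp
    · have hn' : (n : ℂ) ≠ 0 := by exact_mod_cast hn
      have h1 := nsmul_coeff_expSeries h hc n
      rw [← Nat.cast_smul_eq_nsmul ℂ] at h1
      rw [← inv_smul_smul₀ hn' (PowerSeries.coeff n (expSeries h)), h1]
      refine S.smul_mem (S.neg_mem (S.sum_mem fun k hk => S.mul_mem (hS _ ?_) (ih k ?_))) _ <;>
        simp at hk <;> omega

end Exp

/-! ### Families satisfying the relations of the loop algebra of `sl₂` -/

section Ring

variable {B : Type*} [Ring B] {E H K X : B}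

/-- Moving `E` through `X ^ N` leaves an `H` at each of the `N` places, and moving that `H` through
the `j` factors to its right costs `2j` copies of `K`; these add up to `N(N-1)`. Taking `N = n + 2`
avoids truncated subtraction. -/
theorem mul_pow_add_two_of_bracket (h0 : E * X = X * E + H) (h1 : H * X = X * H - 2 * K)
    (h2 : Commute X K) (n : ℕ) :
    E * X ^ (n + 2) = X ^ (n + 2) * E +
      (n + 2) • (X ^ (n + 1) * H - (n + 1) • (X ^ n * K)) := by
  induction n with
  | zero =>
    simp only [zero_add, pow_one, pow_zero, one_mul, one_smul, pow_two]
    rw [← mul_assoc, h0, add_mul, mul_assoc, h0, h1]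
    noncomm_ring
  | succ n ih =>
    have h3 : X ^ n * K * X = X ^ (n + 1) * K := by rw [mul_assoc, ← h2.eq, ← mul_assoc, ← pow_succ]
    have h4 : X ^ (n + 1) * H * X = X ^ (n + 2) * H - 2 • (X ^ (n + 1) * K) := by
      rw [mul_assoc, h1, mul_sub, ← mul_assoc, ← pow_succ, two_mul, mul_add, two_nsmul]
    rw [pow_succ _ (n + 2), ← mul_assoc, ih, add_mul, mul_assoc, h0, mul_add, ← mul_assoc,
      smul_mul_assoc, sub_mul, smul_mul_assoc, h3, h4]
    module

end Ring

/-- Three families indexed by `ℤ` satisfying the defining relations of the loop algebra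
of `sl₂`. -/
structure LoopSl2 {A : Type*} [Ring A] (e f h : ℤ → A) : Prop where
  e_f : ∀ m n, e m * f n = f n * e m + h (m + n)
  h_e : ∀ m n, h m * e n = e n * h m + 2 * e (m + n)
  h_f : ∀ m n, h m * f n = f n * h m - 2 * f (m + n)
  h_h : ∀ m n, Commute (h m) (h n)
  f_f : ∀ m n, Commute (f m) (f n)

namespace LoopSl2

variable {A : Type*} [Ring A] {e f h : ℤ → A}

/-- The symmetry `t ↦ t⁻¹`, which transfers vanishing statements from `Λ⁺` to `Λ⁻`. -/
theorem neg (L : LoopSl2 e f h) :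
    LoopSl2 (fun m => e (-m)) (fun m => f (-m)) fun m => h (-m) where
  e_f m n := by simp only [L.e_f, neg_add]
  h_e m n := by simp only [L.h_e, neg_add]
  h_f m n := by simp only [L.h_f, neg_add]
  h_h _ _ := L.h_h _ _
  f_f _ _ := L.f_f _ _

/-- The series `∑_{m ≥ 0} f m u ^ (m + 1)`. -/
def lowSeries (f : ℤ → A) : A⟦X⟧ := PowerSeries.X * PowerSeries.mk fun m : ℕ => f m

@[simp] theorem constantCoeff_lowSeries : PowerSeries.constantCoeff (lowSeries f) = 0 := by
  simp [lowSeries]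

@[simp] theorem coeff_succ_lowSeries (n : ℕ) :
    PowerSeries.coeff (n + 1) (lowSeries f) = f n := by
  simp [lowSeries, PowerSeries.coeff_succ_X_mul]

/-- The index `1` is chosen so that `[e_1, f_n] = h_{n+1}` lands in degree `n + 1`: the bracket is
exactly the series governing the Euler derivative of `Λ`. -/
theorem C_mul_lowSeries (L : LoopSl2 e f h) :
    PowerSeries.C (e 1) * lowSeries f = lowSeries f * PowerSeries.C (e 1)
      + posSeries fun k => h k := by
  ext n
  rcases n with _ | n
  · simp [posSeries]
  · simp [posSeries, L.e_f, add_comm]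

/-- In degree `N ≥ 1` there are `N - 1` pairs `h_a`, `f_b` with `a ≥ 1`, `b ≥ 0` and `a + b = N -
1`, each with bracket `-2 f_{N-1}`. The count `N - 1` is the eigenvalue of `euler - 1`. -/
theorem posSeries_mul_lowSeries (L : LoopSl2 e f h) :
    (posSeries fun k => h k) * lowSeries f = lowSeries f * (posSeries fun k => h k)
      - 2 * (euler (lowSeries f) - lowSeries f) := by
  set P : A⟦X⟧ := PowerSeries.mk fun m : ℕ => f m with hP
  set Q : A⟦X⟧ := PowerSeries.mk fun m : ℕ => h (m + 1) with hQ
  have h1 : (posSeries fun k => h k) = PowerSeries.X * Q := by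
    ext n
    rcases n with _ | n <;> simp [posSeries, hQ, PowerSeries.coeff_succ_X_mul]
  have h2 : lowSeries f = PowerSeries.X * P := rfl
  have h3 : euler (lowSeries f) - lowSeries f = PowerSeries.X * euler P := by
    ext n
    rcases n with _ | n
    · simp [← PowerSeries.coeff_zero_eq_constantCoeff_apply (euler _)]
    · simp [hP, PowerSeries.coeff_succ_X_mul, add_mul]
  -- The same identity with one factor `u` removed: all `n + 1` antidiagonal terms contribute the
  -- same element `2 f_{n+1}`.
  have h4 : PowerSeries.X * (Q * P) = PowerSeries.X * (P * Q) - 2 * euler P := by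
    ext n
    rcases n with _ | n
    · simp [two_mul, ← PowerSeries.coeff_zero_eq_constantCoeff_apply (euler _)]
    · rw [PowerSeries.coeff_succ_X_mul, map_sub, PowerSeries.coeff_succ_X_mul,
        PowerSeries.coeff_mul, PowerSeries.coeff_mul, ← Finset.Nat.sum_antidiagonal_swap (n := n)
          (f := fun p => PowerSeries.coeff p.1 P * PowerSeries.coeff p.2 Q), eq_sub_iff_add_eq,
        ← eq_sub_iff_add_eq', ← Finset.sum_sub_distrib]
      have : ∀ p ∈ Finset.HasAntidiagonal.antidiagonal n,
          PowerSeries.coeff p.swap.1 P * PowerSeries.coeff p.swap.2 Q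
            - PowerSeries.coeff p.1 Q * PowerSeries.coeff p.2 P = 2 * f (n + 1 : ℕ) := by
        intro p hp
        rw [Finset.HasAntidiagonal.mem_antidiagonal] at hp
        simp only [hP, hQ, PowerSeries.coeff_mk, Prod.fst_swap, Prod.snd_swap, L.h_f, sub_sub_cancel]
        rw [← hp]
        push_cast
        congr 2
        ring
      rw [Finset.sum_congr rfl this, Finset.sum_const, Finset.Nat.card_antidiagonal, two_mul,
        map_add, coeff_euler, hP, PowerSeries.coeff_mk, two_mul, smul_add]
  have hX : ∀ F : A⟦X⟧, F * PowerSeries.X = PowerSeries.X * F := fun F => (PowerSeries.commute_X F).eq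
  rw [h3, h2, h1]
  calc PowerSeries.X * Q * (PowerSeries.X * P)
      = PowerSeries.X * (PowerSeries.X * (Q * P)) := by rw [mul_assoc, ← mul_assoc Q, hX, mul_assoc]
    _ = PowerSeries.X * (PowerSeries.X * (P * Q)) - 2 * (PowerSeries.X * euler P) := by
      rw [h4, mul_sub, two_mul, two_mul, mul_add]
    _ = _ := by rw [mul_assoc, ← mul_assoc P, hX P, mul_assoc]

theorem commute_lowSeries_euler (L : LoopSl2 e f h) :
    Commute (lowSeries f) (euler (lowSeries f)) := by
  refine commute_of_coeff fun i j => ?_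
  rw [coeff_euler]
  refine Commute.smul_right ?_ _
  rcases i with _ | i <;> rcases j with _ | j <;> simp [L.f_f]

variable [Algebra ℂ A]

/-- The key commutation formula behind Garland's identity. -/
theorem C_mul_lowSeries_pow (L : LoopSl2 e f h) (r : ℕ) :
    PowerSeries.C (e 1) * (lowSeries f ^ (r + 1) * expSeries fun k => h k) =
      lowSeries f ^ (r + 1) * (PowerSeries.C (e 1) * expSeries fun k => h k)
      - (r + 1) • (euler (lowSeries f ^ r * expSeries fun k => h k)
        - r • (lowSeries f ^ r * expSeries fun k => h k)) := by
  have hΛ := euler_expSeries (A := A) (fun k => h k) fun _ _ => L.h_h _ _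
  have hc := L.commute_lowSeries_euler
  set Λ : A⟦X⟧ := expSeries fun k => h k
  set H : A⟦X⟧ := posSeries fun k => h k
  rcases r with _ | r
  · simp only [zero_add, pow_one, pow_zero, one_mul, one_smul, zero_smul, sub_zero]
    rw [← mul_assoc, L.C_mul_lowSeries, add_mul, hΛ, mul_assoc, sub_neg_eq_add]
  -- Here `K = euler F - F`. The `H` standing next to `Λ` becomes `-euler Λ`, so the terms recombine
  -- into the Euler derivative of `F ^ (r + 1) * Λ`; the `-F` in `K` produces the correction by a
  -- multiple of that product.
  · have h1 := mul_pow_add_two_of_bracket L.C_mul_lowSeries L.posSeries_mul_lowSeries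
      (hc.sub_right (Commute.refl _)) r
    rw [← mul_assoc, h1, euler_mul, hΛ, euler_pow_succ hc]
    have h2 : ∀ y, lowSeries f ^ r * (lowSeries f * y) = lowSeries f ^ (r + 1) * y := fun y => by
      rw [← mul_assoc, ← pow_succ]
    simp only [add_mul, sub_mul, mul_sub, smul_mul_assoc, mul_assoc, smul_sub, h2, mul_neg, H]
    module

end LoopSl2

namespace LoopSl2

/-! ### Highest weight vectors for the loop algebra of `sl₂` -/

section Module

variable {A : Type*} [Ring A] {e f h : ℤ → A} {V : Type*} [AddCommGroup V] [Module A V] {w : V}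

theorem e_smul_h_smul (L : LoopSl2 e f h) (hw : ∀ m, e m • w = 0) (m n : ℤ) :
    e m • h n • w = 0 := by
  have := congrArg (· • w) (L.h_e n m)
  simp only [two_mul, add_smul, mul_smul, hw, smul_zero, add_zero] at this
  exact this.symm

/-- Apply `e 0` to the relation for the `f`'s: the terms in which `e 0` passes to the right die on
`g k • w`, and the brackets `[e_0, f_{n-k}] = h_{n-k}` remain. -/
theorem sum_range_h_mul_smul (L : LoopSl2 e f h) {N : ℕ} {g : ℕ → A}
    (hg : ∀ m k, e m • g k • w = 0)
    (hc : ∀ n : ℤ, (∑ k ∈ Finset.range N, f (n - k) * g k) • w = 0) (n : ℤ) :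
    (∑ k ∈ Finset.range N, h (n - k) * g k) • w = 0 := by
  have h1 := congrArg (e 0 • ·) (hc n)
  simp only [← mul_smul, Finset.mul_sum, ← mul_assoc, L.e_f, add_mul, Finset.sum_add_distrib,
    zero_add, add_smul, smul_zero] at h1
  have h2 : (∑ k ∈ Finset.range N, f (n - k) * e 0 * g k) • w = 0 := by
    rw [Finset.sum_smul]
    exact Finset.sum_eq_zero fun k _ => by rw [mul_smul, mul_smul, hg, smul_zero]
  rwa [h2, zero_add] at h1

theorem ofNat_two_mul_smul [Module ℂ V] (a : A) (x : V) : (2 * a) • x = (2 : ℂ) • a • x := by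
  rw [two_mul, add_smul, two_smul]

variable [Algebra ℂ A] [Module ℂ V] [IsScalarTower ℂ A V]

theorem h_smul_f_pow_smul (L : LoopSl2 e f h) {c : ℂ} (hc : h 0 • w = c • w) (n : ℕ) :
    h 0 • f 0 ^ n • w = (c - 2 * n) • f 0 ^ n • w := by
  induction n with
  | zero => simp [hc]
  | succ n ih =>
    rw [pow_succ', mul_smul, ← mul_smul, L.h_f, sub_smul, mul_smul, ih, zero_add,
      ofNat_two_mul_smul, smul_comm]
    generalize f 0 • f 0 ^ n • w = x
    push_cast
    module

theorem e_smul_f_pow_succ_smul (L : LoopSl2 e f h) (hw : e 0 • w = 0) {c : ℂ}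
    (hc : h 0 • w = c • w) (n : ℕ) :
    e 0 • f 0 ^ (n + 1) • w = ((n + 1) * (c - n)) • f 0 ^ n • w := by
  induction n with
  | zero => simp [← mul_smul, L.e_f, add_smul, hc, mul_smul (f 0), hw]
  | succ n ih =>
    rw [pow_succ', mul_smul, ← mul_smul, L.e_f, add_smul, mul_smul, ih, zero_add,
      L.h_smul_f_pow_smul hc, smul_comm, ← mul_smul, ← pow_succ']
    generalize f 0 ^ (n + 1) • w = x
    push_cast
    module

/-- If the lowering operator is nilpotent on a highest weight vector, then the weight is a natural
number `ℓ` and the vector is killed by the power `ℓ + 1` of the lowering operator. -/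
theorem exists_weight_eq_natCast (L : LoopSl2 e f h) (hw : e 0 • w = 0) {c : ℂ}
    (hc : h 0 • w = c • w) (hn : ∃ N, f 0 ^ N • w = 0) (h0 : w ≠ 0) :
    ∃ ℓ : ℕ, c = ℓ ∧ f 0 ^ (ℓ + 1) • w = 0 := by
  classical
  obtain ⟨n, hn1⟩ : ∃ n, Nat.find hn = n + 1 := by
    refine Nat.exists_eq_succ_of_ne_zero fun h1 => h0 ?_
    simpa [h1] using Nat.find_spec hn
  have h2 : f 0 ^ n • w ≠ 0 := Nat.find_min hn (by omega)
  have h3 : f 0 ^ (n + 1) • w = 0 := hn1 ▸ Nat.find_spec hn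
  -- At the first vanishing power, applying `e 0` gives `(n + 1)(c - n) f_0^n w = 0` with `f_0^n w ≠
  -- 0`, which forces `c = n`.
  have h4 := L.e_smul_f_pow_succ_smul hw hc n
  rw [h3, smul_zero, eq_comm, smul_eq_zero, or_iff_left h2, mul_eq_zero, sub_eq_zero] at h4
  exact ⟨n, h4.resolve_left (by exact_mod_cast Nat.succ_ne_zero n), h3⟩

theorem f_pow_smul_eq_zero (L : LoopSl2 e f h) (hw : e 0 • w = 0) {ℓ : ℕ}
    (hc : h 0 • w = (ℓ : ℂ) • w) (hn : ∃ N, f 0 ^ N • w = 0) {m : ℕ} (hm : ℓ < m) :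
    f 0 ^ m • w = 0 := by
  rcases eq_or_ne w 0 with rfl | h0
  · simp
  · obtain ⟨n, h1, h2⟩ := L.exists_weight_eq_natCast hw hc hn h0
    obtain rfl : ℓ = n := by exact_mod_cast h1
    obtain ⟨k, rfl⟩ := Nat.exists_eq_add_of_lt hm
    rw [show ℓ + k + 1 = k + (ℓ + 1) by ring, pow_add, mul_smul, h2, smul_zero]

/-- Otherwise the vectors `f_0^n w` would be eigenvectors of `h 0` for the infinitely many distinct
eigenvalues `c - 2n`. -/
theorem exists_f_pow_smul_eq_zero [FiniteDimensional ℂ V] (L : LoopSl2 e f h) {c : ℂ}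
    (hc : h 0 • w = c • w) : ∃ N, f 0 ^ N • w = 0 := by
  by_contra! hne
  have h1 : ∀ n : ℕ, (Algebra.lsmul ℂ ℂ V (h 0)).HasEigenvalue (c - 2 * n) := fun n =>
    Module.End.hasEigenvalue_of_hasEigenvector
      (Module.End.hasEigenvector_iff.mpr
        ⟨Module.End.mem_eigenspace_iff.mpr (L.h_smul_f_pow_smul hc n), hne n⟩)
  refine Set.infinite_of_injective_forall_mem (f := fun n : ℕ => c - 2 * (n : ℂ))
    (fun a b hab => ?_) h1 (Module.End.finite_hasEigenvalue (Algebra.lsmul ℂ ℂ V (h 0)))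
  simpa using hab

theorem e_smul_coeff_expSeries (L : LoopSl2 e f h) (hw : ∀ m, e m • w = 0) (m : ℤ) (n : ℕ) :
    e m • PowerSeries.coeff n (expSeries fun k => h k) • w = 0 := by
  induction n using Nat.strong_induction_on generalizing m with
  | _ n ih =>
    rcases eq_or_ne n 0 with rfl | hn
    · simp [hw]
    · have hn' : (n : ℂ) ≠ 0 := by exact_mod_cast hn
      have h1 := congrArg (· • w)
        (nsmul_coeff_expSeries (A := A) (fun k => h k) (fun _ _ => L.h_h _ _) n)
      simp only [← Nat.cast_smul_eq_nsmul ℂ, smul_assoc] at h1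
      rw [← inv_smul_smul₀ hn' (PowerSeries.coeff n (expSeries fun k => h k) • w), h1, smul_comm,
        neg_smul, Finset.sum_smul, smul_neg, Finset.smul_sum, Finset.sum_eq_zero, neg_zero,
        smul_zero]
      intro k hk
      rw [mul_smul]
      exact L.e_smul_h_smul (fun m => ih k (by simpa using hk) m) _ _

/-- On the coefficient of `u^m` the Euler operator is multiplication by `m`, whence the factor `m -
r`; the remaining term vanishes because `e 1` kills every `Λ_k w`. -/
theorem e_smul_coeff_lowSeries_pow_mul (L : LoopSl2 e f h) (hw : ∀ m, e m • w = 0) (r m : ℕ) :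
    e 1 • PowerSeries.coeff m (lowSeries f ^ (r + 1) * expSeries fun k => h k) • w =
      -((r + 1 : ℂ) * (m - r)) •
        PowerSeries.coeff m (lowSeries f ^ r * expSeries fun k => h k) • w := by
  have h1 := congrArg (PowerSeries.coeff m · • w) (L.C_mul_lowSeries_pow r)
  simp only [PowerSeries.coeff_C_mul, map_sub, map_nsmul, coeff_euler, sub_smul] at h1
  have h2 : PowerSeries.coeff m (lowSeries f ^ (r + 1) *
      (PowerSeries.C (e 1) * expSeries fun k => h k)) • w = 0 := by
    rw [PowerSeries.coeff_mul, Finset.sum_smul]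
    refine Finset.sum_eq_zero fun p _ => ?_
    rw [PowerSeries.coeff_C_mul, mul_smul, mul_smul, L.e_smul_coeff_expSeries hw, smul_zero]
  rw [← mul_smul, h1, h2]
  simp only [← Nat.cast_smul_eq_nsmul ℂ, ← sub_smul, smul_assoc]
  generalize PowerSeries.coeff m (lowSeries f ^ r * expSeries fun k => h k) • w = x
  push_cast
  module

/-- Garland's identity, in the form in which it yields relations in highest weight modules. -/
theorem coeff_lowSeries_pow_mul_smul (L : LoopSl2 e f h) (hw : ∀ m, e m • w = 0) {m : ℕ}
    (hf : f 0 ^ m • w = 0) (r : ℕ) :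
    PowerSeries.coeff m (lowSeries f ^ r * expSeries fun k => h k) • w = 0 := by
  have hX : ∀ r, lowSeries f ^ r =
      PowerSeries.X ^ r * (PowerSeries.mk fun m : ℕ => f m) ^ r := fun r =>
    (PowerSeries.commute_X _).symm.mul_pow r
  rcases lt_or_ge m r with hr | hr
  · rw [hX, mul_assoc, PowerSeries.coeff_X_pow_mul', if_neg (by omega), zero_smul]
  -- Descending induction from `r = m`, where the coefficient is the lowest one of `F^m Λ`, namely
  -- `f_0^m`. Passing from `k + 1` to `k` divides by `(k + 1)(m - k)`, nonzero since `k < m`.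
  · induction hr using Nat.decreasingInduction with
    | self =>
      rw [hX, mul_assoc, PowerSeries.coeff_X_pow_mul', if_pos le_rfl, Nat.sub_self,
        PowerSeries.coeff_zero_eq_constantCoeff_apply, map_mul, map_pow,
        ← PowerSeries.coeff_zero_eq_constantCoeff_apply,
        ← PowerSeries.coeff_zero_eq_constantCoeff_apply, coeff_zero_expSeries, mul_one,
        PowerSeries.coeff_mk]
      exact_mod_cast hf
    | of_succ k hk ih =>
      have h1 := L.e_smul_coeff_lowSeries_pow_mul hw k m
      rw [ih, smul_zero, eq_comm, smul_eq_zero, neg_eq_zero, mul_eq_zero, sub_eq_zero] at h1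
      refine h1.resolve_left (not_or.mpr ⟨by exact_mod_cast Nat.succ_ne_zero k, ?_⟩)
      exact_mod_cast hk.ne'

theorem coeff_expSeries_smul (L : LoopSl2 e f h) (hw : ∀ m, e m • w = 0) {m : ℕ}
    (hf : f 0 ^ m • w = 0) : PowerSeries.coeff m (expSeries fun k => h k) • w = 0 := by
  simpa using L.coeff_lowSeries_pow_mul_smul hw hf 0

theorem commute_h_coeff_expSeries (L : LoopSl2 e f h) (s : ℤ) (n : ℕ) :
    Commute (h s) (PowerSeries.coeff n (expSeries fun k => h k)) := by
  have := coeff_expSeries_mem (fun k => h k) (fun _ _ => L.h_h _ _)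
    (Subalgebra.centralizer ℂ {h s}) (fun k _ => by
      rw [Subalgebra.mem_centralizer_iff]
      rintro _ rfl
      exact (L.h_h _ _).eq) n
  exact (Subalgebra.mem_centralizer_iff ℂ).mp this _ rfl

/-- Garland's identity with `r = 1` in degree `ℓ + 1`. There every index `ℓ - k` is nonnegative, so
the one-sided series already gives the full coefficient of the two-sided one. -/
theorem sum_range_f_mul_smul_of_lt (L : LoopSl2 e f h) (hw : ∀ m, e m • w = 0) {ℓ : ℕ}
    (hf : ∀ m, ℓ < m → f 0 ^ m • w = 0) :
    (∑ k ∈ Finset.range (ℓ + 1),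
      f (ℓ - k) * PowerSeries.coeff k (expSeries fun k => h k)) • w = 0 := by
  have h1 := L.coeff_lowSeries_pow_mul_smul hw (hf (ℓ + 1) (Nat.lt_succ_self ℓ)) 1
  rw [pow_one, lowSeries, mul_assoc, PowerSeries.coeff_succ_X_mul, PowerSeries.coeff_mul,
    ← Finset.Nat.sum_antidiagonal_swap, Finset.Nat.sum_antidiagonal_eq_sum_range_succ_mk] at h1
  rw [← h1]
  congr 1
  refine Finset.sum_congr rfl fun k hk => ?_
  simp only [Prod.fst_swap, Prod.snd_swap, PowerSeries.coeff_mk]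
  rw [Nat.cast_sub (by simp at hk; omega)]

/-- The coefficients of `(∑ k : ℤ, f k u ^ (k + 1)) Λ⁺(u)` kill highest weight vectors. -/
theorem sum_range_f_mul_smul (L : LoopSl2 e f h) (hw : ∀ m, e m • w = 0) {ℓ : ℕ}
    (hf : ∀ m, ℓ < m → f 0 ^ m • w = 0) (hfh : ∀ s m, ℓ < m → f 0 ^ m • h s • w = 0) (n : ℤ) :
    (∑ k ∈ Finset.range (ℓ + 1),
      f (n - k) * PowerSeries.coeff k (expSeries fun k => h k)) • w = 0 := by
  -- Apply `h (n - ℓ)` to the relation at index `ℓ`. It commutes with `Λ_k`, and `[h_s, f_m] = -2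
  -- f_{m+s}` shifts the index to `n`. The leftover term is the index-`ℓ` relation for the highest
  -- weight vector `h_{n-ℓ} w`, hence zero.
  set g : ℕ → A := fun k => PowerSeries.coeff k (expSeries fun k => h k)
  have h1 := congrArg (h (n - ℓ) • ·) (L.sum_range_f_mul_smul_of_lt hw hf)
  have h2 := L.sum_range_f_mul_smul_of_lt (L.e_smul_h_smul hw · (n - ℓ)) (hfh (n - ℓ))
  rw [← mul_smul, Finset.sum_mul] at h2
  simp only [← mul_smul, Finset.mul_sum, ← mul_assoc, L.h_f, sub_mul, Finset.sum_sub_distrib,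
    sub_smul, smul_zero] at h1
  have h3 : ∀ k ∈ Finset.range (ℓ + 1), f (ℓ - k) * h (n - ℓ) * g k = f (ℓ - k) * g k * h (n - ℓ) :=
    fun k _ => by rw [mul_assoc, (L.commute_h_coeff_expSeries _ _).eq, mul_assoc]
  rw [Finset.sum_congr rfl h3, h2, zero_sub, neg_eq_zero] at h1
  simp only [mul_assoc, ← Finset.mul_sum] at h1
  rw [two_mul, add_smul, ← two_smul ℂ, smul_eq_zero, or_iff_right two_ne_zero] at h1
  rw [← h1]
  congr 1
  refine Finset.sum_congr rfl fun k _ => ?_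
  rw [show n - ℓ + (ℓ - k) = n - (k : ℤ) by ring]

/-- The relation `Λ_ℓ Λ_{-j} = Λ_{ℓ-j}` on highest weight vectors. -/
theorem coeff_mul_coeff_smul (L : LoopSl2 e f h) (hw : ∀ m, e m • w = 0) {ℓ : ℕ}
    (hc : h 0 • w = (ℓ : ℂ) • w)
    (hf : ∀ m, ℓ < m → f 0 ^ m • w = 0) (hfh : ∀ s m, ℓ < m → f 0 ^ m • h s • w = 0) {j : ℕ}
    (hj : j ≤ ℓ) :
    (PowerSeries.coeff ℓ (expSeries fun k => h k) *
      PowerSeries.coeff j (expSeries fun k => h (-k))) • w =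
      PowerSeries.coeff (ℓ - j) (expSeries fun k => h k) • w := by
  set g : ℕ → A := fun k => PowerSeries.coeff k (expSeries fun k => h k) with hg
  set g' : ℕ → A := fun k => PowerSeries.coeff k (expSeries fun k => h (-k)) with hg'
  change (g ℓ * g' j) • w = g (ℓ - j) • w
  induction j using Nat.strong_induction_on with
  | _ j ih =>
    rcases eq_or_ne j 0 with rfl | hj0
    · simp [hg']
    obtain ⟨N, rfl⟩ := Nat.exists_eq_add_of_le' hj
    rw [Nat.add_sub_cancel]
    -- Newton's recursion for `Λ_{-j}`, with the products `Λ_ℓ Λ_{-k}` for `k < j` rewritten by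
    -- induction.
    have h1 : (j : ℂ) • (g (N + j) * g' j) • w =
        -∑ k ∈ Finset.range j, h (-(j - k : ℤ)) • g (N + j - k) • w := by
      have h2 := congrArg (fun x => (g (N + j) * x) • w)
        (nsmul_coeff_expSeries (A := A) (fun k => h (-k)) (fun _ _ => L.h_h _ _) j)
      simp only [← Nat.cast_smul_eq_nsmul ℂ, mul_smul_comm, smul_assoc] at h2
      rw [h2, mul_neg, neg_smul, Finset.mul_sum, Finset.sum_smul]
      congr 1
      refine Finset.sum_congr rfl fun k hk => ?_
      have hk' : k < j := by simpa using hk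
      rw [← ih k hk' (by omega), ← mul_smul, ← mul_assoc, ← mul_assoc,
        (L.commute_h_coeff_expSeries _ _).eq, Nat.cast_sub hk'.le]
    have h3 : (N : ℂ) • g N • w = -∑ k ∈ Finset.range N, (h (N - k) * g k) • w := by
      rw [← smul_assoc, Nat.cast_smul_eq_nsmul, hg,
        nsmul_coeff_expSeries (A := A) (fun k => h k) (fun _ _ => L.h_h _ _) N, neg_smul,
        Finset.sum_smul]
      congr 1
      refine Finset.sum_congr rfl fun k hk => ?_
      rw [Nat.cast_sub (by simp at hk; omega)]
    -- Split this sum at `k = N`, where `N = ℓ - j`. The terms below give `-N Λ_N w` by Newton, the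
    -- term `k = N` gives `ℓ Λ_N w`, and those above are the sum in `h1`; the total shows that `h1`
    -- equals `(ℓ - N) Λ_N w = j Λ_N w`.
    have h4 : (∑ k ∈ Finset.range (N + j + 1), h (N - k) * g k) • w = 0 :=
      L.sum_range_h_mul_smul (L.e_smul_coeff_expSeries hw)
      (L.sum_range_f_mul_smul hw hf hfh) N
    have h5 : (h 0 * g N) • w = ((N + j : ℕ) : ℂ) • g N • w := by
      rw [(L.commute_h_coeff_expSeries _ _).eq, mul_smul, hc, smul_comm]
    rw [show N + j + 1 = N + 1 + j by ring, Finset.sum_range_add, Finset.sum_range_succ, add_smul,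
      add_smul, Finset.sum_smul, sub_self, ← Finset.sum_range_reflect _ j, Finset.sum_smul] at h4
    have h6 : ∀ k ∈ Finset.range j, (h ((N : ℤ) - (N + 1 + (j - 1 - k) : ℕ)) *
        g (N + 1 + (j - 1 - k))) • w = h (-(j - k : ℤ)) • g (N + j - k) • w := by
      intro k hk
      have hk' : k < j := by simpa using hk
      rw [← mul_smul]
      congr 3
      · omega
      · omega
    rw [Finset.sum_congr rfl h6, h5] at h4
    have hj' : (j : ℂ) ≠ 0 := by exact_mod_cast hj0
    refine smul_right_injective V hj' ?_
    change (j : ℂ) • _ = (j : ℂ) • _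
    rw [h1, neg_eq_iff_add_eq_zero, ← h4, eq_neg_iff_add_eq_zero.mp h3 |> eq_neg_of_add_eq_zero_right]
    generalize g N • w = x
    push_cast
    module

end Module

end LoopSl2

/-! ### Brackets of the elements `x ⊗ t ^ m` -/

section El

variable {𝔤 : Type*} [LieRing 𝔤] [LieAlgebra ℂ 𝔤]

theorem lie_tmul (x y : 𝔤) (m n : ℤ) : ⁅tmul x m, tmul y n⁆ = tmul ⁅x, y⁆ (m + n) := by
  rw [tmul, tmul, LieAlgebra.ExtendScalars.bracket_tmul, AddMonoidAlgebra.single_mul_single,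
    mul_one, tmul]

theorem el_mul_el (x y : 𝔤) (m n : ℤ) :
    el x m * el y n = el y n * el x m + el ⁅x, y⁆ (m + n) := by
  rw [el, el, el, ← lie_tmul, LieHom.map_lie, LieRing.of_associative_ring_bracket]
  abel

theorem el_smul (c : ℂ) (x : 𝔤) (m : ℤ) : el (c • x) m = c • el x m := by
  simp [el, tmul, TensorProduct.tmul_smul]

theorem el_neg (x : 𝔤) (m : ℤ) : el (-x) m = -el x m := by
  simp [el, tmul, TensorProduct.tmul_neg]

theorem el_two_nsmul (x : 𝔤) (m : ℤ) : el (2 • x) m = 2 * el x m := by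
  rw [← Nat.cast_smul_eq_nsmul ℂ, el_smul, two_mul, Nat.cast_ofNat, two_smul]

theorem commute_el {x y : 𝔤} (h : ⁅x, y⁆ = 0) (m n : ℤ) : Commute (el x m) (el y n) := by
  rw [Commute, SemiconjBy, el_mul_el, h, ← zero_smul ℂ (0 : 𝔤), el_smul, zero_smul, add_zero]

end El

/-! ### The loop `sl₂` of each simple root, and the action of `U(0)` -/

section Main

open LieAlgebra.IsKilling

variable {𝔤 : Type*} [LieRing 𝔤] [LieAlgebra ℂ 𝔤] [FiniteDimensional ℂ 𝔤]
  [LieAlgebra.IsSimple ℂ 𝔤] {𝔥 : LieSubalgebra ℂ 𝔤} [𝔥.IsCartanSubalgebra]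

theorem lie_cartan_eq_zero (x y : 𝔥) : ⁅(x : 𝔤), (y : 𝔤)⁆ = 0 := by
  rw [← LieSubalgebra.coe_bracket, trivial_lie_zero, ZeroMemClass.coe_zero]

theorem commute_el_of_mem_U0 {y : U 𝔤} (hy : y ∈ U0 𝔥) (x : 𝔥) (m : ℤ) :
    Commute (el (x : 𝔤) m) y := by
  have : U0 𝔥 ≤ Subalgebra.centralizer ℂ {el (x : 𝔤) m} := by
    refine Algebra.adjoin_le ?_
    rintro _ ⟨α, k, _, rfl⟩
    rw [SetLike.mem_coe, Subalgebra.mem_centralizer_iff]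
    rintro _ rfl
    exact commute_el (lie_cartan_eq_zero _ _) _ _
  exact (Subalgebra.mem_centralizer_iff ℂ).mp (this hy) _ rfl

theorem el_coroot_mem_U0 (α : 𝔥.root) {m : ℤ} (hm : m ≠ 0) :
    el ((rootSystem 𝔥).coroot α : 𝔤) m ∈ U0 𝔥 :=
  Algebra.subset_adjoin ⟨α, m, hm, rfl⟩

namespace ChevalleyData

variable (D : ChevalleyData 𝔥)

theorem loopSl2 (i : D.I) : LoopSl2 (D.xP i) (D.xM i) (D.hh i) where
  e_f m n := by
    have h := (D.sl2 (D.pos i)).lie_e_f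
    simp only [xP, xM, hh]
    rw [el_mul_el _ _ m n, h, pos]
  h_e m n := by
    have h := (D.sl2 (D.pos i)).lie_h_e_nsmul
    simp only [xP, hh]
    rw [el_mul_el _ _ m n, ← el_two_nsmul, ← h, pos]
  h_f m n := by
    have h := (D.sl2 (D.pos i)).lie_h_f_nsmul
    simp only [xM, hh]
    rw [el_mul_el _ _ m n, ← el_two_nsmul, sub_eq_add_neg, ← el_neg, ← h, pos]
  h_h _ _ := commute_el (lie_cartan_eq_zero _ _) _ _
  f_f _ _ := commute_el (lie_self _) _ _

theorem domWeight_coroot (ℓ : D.I → ℕ) (i : D.I) :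
    D.domWeight ℓ ((rootSystem 𝔥).coroot i.1) = ℓ i := by
  rw [← D.base.toCoweightBasis_apply i, domWeight, Module.Basis.constr_basis]

theorem eq_domWeight {lam : Module.Dual ℂ 𝔥} {ℓ : D.I → ℕ}
    (h : ∀ i : D.I, lam ((rootSystem 𝔥).coroot i.1) = ℓ i) : lam = D.domWeight ℓ :=
  D.base.toCoweightBasis.ext fun i => by
    rw [D.base.toCoweightBasis_apply i, h, domWeight_coroot]

theorem lamP_mem_U0 (i : D.I) (m : ℕ) : D.lamP i m ∈ U0 𝔥 :=
  coeff_expSeries_mem _ (fun _ _ => (D.loopSl2 i).h_h _ _) _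
    (fun k hk => el_coroot_mem_U0 i.1 (by omega)) m

theorem lamM_mem_U0 (i : D.I) (m : ℕ) : D.lamM i m ∈ U0 𝔥 :=
  coeff_expSeries_mem _ (fun _ _ => (D.loopSl2 i).h_h _ _) _
    (fun k hk => el_coroot_mem_U0 i.1 (by omega)) m

theorem smul_eq_zero_of_mem_weylIdeal {V : Type*} [AddCommGroup V] [Module (U 𝔤) V]
    {ℓ : D.I → ℕ} {v : V}
    (h : ∀ y, D.Rel ℓ y → y • v = 0) {y : U 𝔤} (hy : y ∈ D.weylIdeal ℓ) : y • v = 0 := by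
  have : D.weylIdeal ℓ ≤ LinearMap.ker (LinearMap.toSpanSingleton (U 𝔤) V v) :=
    Submodule.span_le.mpr fun y hy => by simpa using h y hy
  simpa using this hy

section Module

variable {V : Type*} [AddCommGroup V] [Module ℂ V] [Module (U 𝔤) V] [IsScalarTower ℂ (U 𝔤) V]

theorem smul_mem_weightSpace {lam : Module.Dual ℂ 𝔥} {v : V} (hv : v ∈ weightSpace V lam)
    {y : U 𝔤} (hy : y ∈ U0 𝔥) : y • v ∈ weightSpace V lam := fun x => by
  rw [← mul_smul, (commute_el_of_mem_U0 hy x 0).eq, mul_smul, hv x, smul_comm]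

theorem el_smul_mem_highestWeightVectors {lam : Module.Dual ℂ 𝔥} {v : V}
    (hv : v ∈ D.highestWeightVectors V lam) (x : 𝔥) (m : ℤ) :
    el (x : 𝔤) m • v ∈ D.highestWeightVectors V lam := by
  refine ⟨fun y => ?_, fun β n => ?_⟩
  · rw [← mul_smul, (commute_el (lie_cartan_eq_zero y x) 0 m).eq, mul_smul, hv.1 y, smul_comm]
  · have h : ⁅(x : 𝔤), D.xp β⁆ = β.1.1 x • D.xp β := lie_eq_smul_of_mem_rootSpace (D.xp_mem β) x
    rw [← mul_smul, el_mul_el, ← lie_skew, h, el_neg, el_smul, add_smul, mul_smul, hv.2, neg_smul,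
      smul_assoc, hv.2]
    simp

/-- Elements `h ⊗ t^m` commute with `𝔥` and bracket each family `x⁺_{β,n}` into itself. This is what
disposes of the factor `y ∈ U(0)` in the relations. -/
theorem smul_mem_highestWeightVectors {lam : Module.Dual ℂ 𝔥} {v : V}
    (hv : v ∈ D.highestWeightVectors V lam) {y : U 𝔤} (hy : y ∈ U0 𝔥) :
    y • v ∈ D.highestWeightVectors V lam := by
  refine ⟨smul_mem_weightSpace hv.1 hy, ?_⟩
  suffices y • v ∈ D.highestWeightVectors V lam from this.2
  induction hy using Algebra.adjoin_induction generalizing v with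
  | mem x hx =>
    obtain ⟨α, m, _, rfl⟩ := hx
    exact D.el_smul_mem_highestWeightVectors hv _ _
  | algebraMap c =>
    rw [algebraMap_smul]
    exact ⟨Submodule.smul_mem _ c hv.1, fun β m => by rw [smul_comm, hv.2, smul_zero]⟩
  | add x y _ _ hx hy =>
    rw [add_smul]
    exact ⟨add_mem (hx hv).1 (hy hv).1, fun β m => by
      rw [smul_add, (hx hv).2, (hy hv).2, add_zero]⟩
  | mul x y _ _ hx hy =>
    rw [mul_smul]
    exact hx (hy hv)

theorem hh_zero_smul {lam : Module.Dual ℂ 𝔥} {v : V} (hv : v ∈ weightSpace V lam) (i : D.I) :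
    D.hh i 0 • v = lam ((rootSystem 𝔥).coroot i.1) • v := hv _

theorem exists_eq_domWeight {lam : Module.Dual ℂ 𝔥} {v : V}
    (hv : v ∈ D.highestWeightVectors V lam) (h0 : v ≠ 0)
    (hn : ∀ i : D.I, ∃ N : ℕ, D.xM i 0 ^ N • v = 0) : ∃ ℓ : D.I → ℕ, lam = D.domWeight ℓ := by
  choose ℓ hℓ _ using fun i : D.I => (D.loopSl2 i).exists_weight_eq_natCast (hv.2 (D.pos i) 0)
    (D.hh_zero_smul hv.1 i) (hn i) h0
  exact ⟨ℓ, D.eq_domWeight hℓ⟩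

/-- The defining relations of `W(λ)` hold for highest weight vectors on which the lowering
operators are locally nilpotent. -/
theorem rel_smul_eq_zero {ℓ : D.I → ℕ} {v : V}
    (hv : v ∈ D.highestWeightVectors V (D.domWeight ℓ))
    (hn : ∀ i : D.I, ∀ w ∈ D.highestWeightVectors V (D.domWeight ℓ), ∃ N : ℕ, D.xM i 0 ^ N • w = 0)
    {y : U 𝔤} (hy : D.Rel ℓ y) : y • v = 0 := by
  have he : ∀ i : D.I, ∀ w ∈ D.highestWeightVectors V (D.domWeight ℓ), ∀ m, D.xP i m • w = 0 :=
    fun i w hw m => hw.2 (D.pos i) m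
  have hh0 : ∀ i : D.I, ∀ w ∈ D.highestWeightVectors V (D.domWeight ℓ),
      D.hh i 0 • w = (ℓ i : ℂ) • w := fun i w hw => by
    rw [D.hh_zero_smul hw.1, domWeight_coroot]
  have hf : ∀ i : D.I, ∀ w ∈ D.highestWeightVectors V (D.domWeight ℓ), ∀ m, ℓ i < m →
      D.xM i 0 ^ m • w = 0 := fun i w hw m hm =>
    (D.loopSl2 i).f_pow_smul_eq_zero (he i w hw 0) (hh0 i w hw) (hn i w hw) hm
  have hfh : ∀ i : D.I, ∀ w ∈ D.highestWeightVectors V (D.domWeight ℓ), ∀ s m, ℓ i < m →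
      D.xM i 0 ^ m • D.hh i s • w = 0 := fun i w hw s m hm =>
    hf i _ (D.el_smul_mem_highestWeightVectors hw _ _) m hm
  induction hy with
  | weight x => rw [sub_smul, hv.1 x, algebraMap_smul, sub_self]
  | lam_pos i m hm => exact (D.loopSl2 i).coeff_expSeries_smul (he i v hv) (hf i v hv m hm)
  | lam_neg i m hm =>
    exact (D.loopSl2 i).neg.coeff_expSeries_smul (fun m => he i v hv (-m))
      (by simpa using hf i v hv m hm)
  | lam_mul i m h1 hm =>
    rw [sub_smul, sub_eq_zero]
    exact (D.loopSl2 i).coeff_mul_coeff_smul (he i v hv) (hh0 i v hv) (hf i v hv) (hfh i v hv) hm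
  | current i m y hy =>
    have hw := D.smul_mem_highestWeightVectors hv hy
    rw [mul_smul]
    -- The shift to `m - 1` reflects that `x⁻_{i,k}` is the coefficient of `u^(k+1)`.
    exact (D.loopSl2 i).sum_range_f_mul_smul (he i _ hw) (hf i _ hw) (hfh i _ hw) (m - 1)
  | garland i r m hr hm y hy =>
    have hw := D.smul_mem_highestWeightVectors hv hy
    rw [mul_smul]
    exact (D.loopSl2 i).coeff_lowSeries_pow_mul_smul (he i _ hw) (hf i _ hw m hm) r
  | raising i m => exact he i v hv m

end Module

end ChevalleyData

/-! ### Homomorphisms from `W(λ)` and `W(π)` -/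

theorem surjective_of_span_eq_top {R M N : Type*} [Ring R] [AddCommGroup M] [Module R M]
    [AddCommGroup N] [Module R N] (φ : M →ₗ[R] N) {m : M} {n : N} (h : φ m = n)
    (hn : Submodule.span R {n} = ⊤) : Function.Surjective φ := by
  rw [← LinearMap.range_eq_top, ← top_le_iff, ← hn, Submodule.span_singleton_le_iff_mem]
  exact ⟨m, h⟩

namespace ChevalleyData

variable (D : ChevalleyData 𝔥)

theorem exists_weylExt_hom {V : Type*} [AddCommGroup V] [Module ℂ V] [Module (Ue 𝔤) V]
    [IsScalarTower ℂ (Ue 𝔤) V] {lam : Module.Dual ℂ 𝔥} {a : ℂ} {v : V} (hV : D.IsIntegrable V)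
    (hv : v ∈ D.highestWeightVectorsExt V lam a) (h0 : v ≠ 0)
    (hspan : Submodule.span (Ue 𝔤) {v} = ⊤) :
    ∃ ℓ : D.I → ℕ, lam = D.domWeight ℓ ∧
      ∃ φ : D.WeylExt ℓ a →ₗ[Ue 𝔤] V, Function.Surjective φ ∧ φ (D.weylExtGen ℓ a) = v := by
  -- Restriction along `U → Uᵉ`, so that the relations proved for `U`-modules apply.
  let _ : Module (U 𝔤) V := Module.compHom V (toUe 𝔤).toRingHom
  have hsmul : ∀ (y : U 𝔤) (w : V), y • w = toUe 𝔤 y • w := fun _ _ => rfl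
  have _ : IsScalarTower ℂ (U 𝔤) V := ⟨fun c y w => by
    rw [hsmul, hsmul, map_smul, smul_assoc]⟩
  have hn : ∀ (i : D.I) (w : V), ∃ N : ℕ, D.xM i 0 ^ N • w = 0 := fun i w => by
    simpa only [hsmul, map_pow] using hV.e_neg i w
  have hv' : v ∈ D.highestWeightVectors V lam := ⟨hv.1.1, hv.2⟩
  obtain ⟨ℓ, rfl⟩ := D.exists_eq_domWeight hv' h0 fun i => hn i v
  refine ⟨ℓ, rfl, ?_⟩
  have hle : D.weylIdealExt ℓ a ≤ LinearMap.ker (LinearMap.toSpanSingleton (Ue 𝔤) V v) := by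
    refine Submodule.span_le.mpr ?_
    rintro _ (⟨y, hy, rfl⟩ | rfl)
    · have := D.smul_eq_zero_of_mem_weylIdeal
        (fun y hy => D.rel_smul_eq_zero hv' (fun i w _ => hn i w) hy) hy
      simpa [hsmul] using this
    · simp [sub_smul, hv.1.2]
  have hgen : (D.weylIdealExt ℓ a).liftQ _ hle (D.weylExtGen ℓ a) = v := by
    simp [weylExtGen]
  exact ⟨_, surjective_of_span_eq_top _ hgen hspan, hgen⟩

variable {V : Type*} [AddCommGroup V] [Module ℂ V] [Module (U 𝔤) V] [IsScalarTower ℂ (U 𝔤) V]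

/-- The line `V_λ` is stable under `U(0)`, so each `Λ_{i,±m}` acts on `v` by a scalar, and the
relations become identities between scalars. These identify the two generating series as a
polynomial and its normalised reversal. -/
theorem exists_polynomials {ℓ : D.I → ℕ} {v : V} (hrel : ∀ y, D.Rel ℓ y → y • v = 0) (h0 : v ≠ 0)
    (hdim : Module.finrank ℂ (weightSpace V (D.domWeight ℓ)) = 1) :
    ∃ p : D.I → Polynomial ℂ, (∀ i, (p i).coeff 0 = 1) ∧ D.degs p = ℓ ∧
      ∀ y, D.RelPi p y → y • v = 0 := by
  have hv : v ∈ weightSpace V (D.domWeight ℓ) := fun x => by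
    simpa [sub_smul, sub_eq_zero] using hrel _ (Rel.weight x)
  have hsc : ∀ w ∈ weightSpace V (D.domWeight ℓ), ∃ c : ℂ, w = c • v := fun w hw => by
    obtain ⟨c, hc⟩ := (finrank_eq_one_iff_of_nonzero' (⟨v, hv⟩ : weightSpace V (D.domWeight ℓ))
      (by simpa using h0)).mp hdim ⟨w, hw⟩
    exact ⟨c, (congrArg Subtype.val hc).symm⟩
  choose cp hcp using fun i m => hsc _ (smul_mem_weightSpace hv (D.lamP_mem_U0 i m))
  choose cm hcm using fun i m => hsc _ (smul_mem_weightSpace hv (D.lamM_mem_U0 i m))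
  have hinj : ∀ a b : ℂ, a • v = b • v → a = b := fun a b h => smul_left_injective ℂ h0 h
  have hcp0 : ∀ i, cp i 0 = 1 := fun i => hinj _ _ <| by
    rw [← hcp, lamP, LamP, coeff_zero_expSeries, one_smul, one_smul]
  have hcm0 : ∀ i, cm i 0 = 1 := fun i => hinj _ _ <| by
    rw [← hcm, lamM, LamM, coeff_zero_expSeries, one_smul, one_smul]
  have hcp1 : ∀ i m, ℓ i < m → cp i m = 0 := fun i m hm => hinj _ _ <| by
    rw [← hcp, hrel _ (Rel.lam_pos i m hm), zero_smul]
  have hcm1 : ∀ i m, ℓ i < m → cm i m = 0 := fun i m hm => hinj _ _ <| by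
    rw [← hcm, hrel _ (Rel.lam_neg i m hm), zero_smul]
  have hmul : ∀ i m, m ≤ ℓ i → cp i (ℓ i) * cm i m = cp i (ℓ i - m) := fun i m hm => by
    rcases Nat.eq_zero_or_pos m with rfl | h1
    · rw [hcm0, mul_one, Nat.sub_zero]
    · have h2 := hrel _ (Rel.lam_mul i m h1 hm)
      rw [sub_smul, sub_eq_zero, mul_smul, hcm, smul_comm, hcp, hcp, smul_smul, mul_comm] at h2
      exact hinj _ _ h2
  -- The relation with `m = ℓ i` reads `cp (ℓ i) * cm (ℓ i) = 1`; hence the degree is exactly `ℓ i`.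
  have hne : ∀ i, cp i (ℓ i) ≠ 0 := fun i h => by
    have := hmul i _ le_rfl
    rw [h, zero_mul, Nat.sub_self, hcp0] at this
    exact zero_ne_one this
  set p : D.I → Polynomial ℂ := fun i =>
    ∑ m ∈ Finset.range (ℓ i + 1), Polynomial.monomial m (cp i m) with hp
  have hcoeff : ∀ i m, (p i).coeff m = cp i m := fun i m => by
    simp only [hp, Polynomial.finsetSum_coeff, Polynomial.coeff_monomial, Finset.sum_ite_eq',
      Finset.mem_range]
    split_ifs with h
    · rfl
    · rw [hcp1 i m (by omega)]
  have hdeg : ∀ i, (p i).natDegree = ℓ i := fun i =>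
    Polynomial.natDegree_eq_of_le_of_coeff_ne_zero
      (Polynomial.natDegree_le_iff_coeff_eq_zero.mpr fun m hm => by rw [hcoeff, hcp1 i m hm])
      (by rw [hcoeff]; exact hne i)
  have hrev : ∀ i m, (revPoly (p i)).coeff m = cm i m := fun i m => by
    rw [revPoly, Polynomial.coeff_C_mul, Polynomial.coeff_zero_reverse, Polynomial.coeff_reverse,
      Polynomial.leadingCoeff, hdeg, hcoeff, hcoeff, inv_mul_eq_iff_eq_mul₀ (hne i)]
    rcases le_or_gt m (ℓ i) with h | h
    · rw [Polynomial.revAt_le h, hmul i m h]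
    -- Beyond the degree `revAt` fixes the index, and both coefficients vanish.
    · rw [Polynomial.revAt_eq_self_of_lt h, hcp1 i m h, hcm1 i m h, mul_zero]
  refine ⟨p, fun i => by rw [hcoeff, hcp0], funext hdeg, ?_⟩
  rintro _ (⟨i, s⟩ | ⟨i, s⟩)
  · rw [sub_smul, algebraMap_smul, hcp, hcoeff, sub_self]
  · rw [sub_smul, algebraMap_smul, hcm, hrev, sub_self]

theorem exists_weylPi_hom {ℓ : D.I → ℕ} (q : D.Weyl ℓ →ₗ[U 𝔤] V) (hq : Function.Surjective q)
    (hdim : Module.finrank ℂ (weightSpace V (D.domWeight ℓ)) = 1) :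
    ∃ p : D.I → Polynomial ℂ, (∀ i, (p i).coeff 0 = 1) ∧
      ∃ φ : D.WeylPi p →ₗ[U 𝔤] V,
        Function.Surjective φ ∧ φ (D.weylPiGen p) = q (D.weylGen ℓ) := by
  have hmk : ∀ y : U 𝔤, q (Submodule.Quotient.mk y) = y • q (D.weylGen ℓ) := fun y => by
    rw [weylGen, ← map_smul, ← Submodule.Quotient.mk_smul, smul_eq_mul, mul_one]
  have hrel : ∀ y, D.Rel ℓ y → y • q (D.weylGen ℓ) = 0 := fun y hy => by
    have h : (Submodule.Quotient.mk y : D.Weyl ℓ) = 0 :=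
      (Submodule.Quotient.mk_eq_zero _).mpr (Submodule.subset_span hy)
    exact (hmk y).symm.trans ((congrArg q h).trans (map_zero q))
  have h0 : q (D.weylGen ℓ) ≠ 0 := fun h => by
    have hz : ∀ a : V, a = 0 := fun a => by
      obtain ⟨x, rfl⟩ := hq a
      obtain ⟨y, rfl⟩ := Submodule.Quotient.mk_surjective _ x
      exact (hmk y).trans (by rw [h, smul_zero])
    have : Subsingleton V := ⟨fun a b => (hz a).trans (hz b).symm⟩
    rw [Module.finrank_zero_of_subsingleton] at hdim
    exact zero_ne_one hdim
  -- Substituting `ℓ = D.degs p` makes `q` itself a map out of `W(λ_π)`, which only has to be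
  -- factored through `weylPiSub`.
  obtain ⟨p, hp0, rfl, hp⟩ := D.exists_polynomials hrel h0 hdim
  refine ⟨p, hp0, (D.weylPiSub p).liftQ q (Submodule.span_le.mpr ?_), ?_, ?_⟩
  · rintro _ ⟨y, hy, rfl⟩
    exact (hmk y).trans (hp y hy)
  · intro w
    obtain ⟨x, rfl⟩ := hq w
    exact ⟨Submodule.Quotient.mk x, rfl⟩
  · rfl

theorem exists_weyl_hom [FiniteDimensional ℂ V] {lam : Module.Dual ℂ 𝔥} {v : V}
    (hv : v ∈ D.highestWeightVectors V lam) (hspan : Submodule.span (U 𝔤) {v} = ⊤) (h0 : v ≠ 0) :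
    ∃ ℓ : D.I → ℕ, lam = D.domWeight ℓ ∧
      ∃ q : D.Weyl ℓ →ₗ[U 𝔤] V, Function.Surjective q ∧ q (D.weylGen ℓ) = v := by
  have hn : ∀ (i : D.I), ∀ w ∈ D.highestWeightVectors V lam, ∃ N : ℕ, D.xM i 0 ^ N • w = 0 :=
    fun i w hw => (D.loopSl2 i).exists_f_pow_smul_eq_zero (D.hh_zero_smul hw.1 i)
  obtain ⟨ℓ, rfl⟩ := D.exists_eq_domWeight hv h0 fun i => hn i v hv
  have hle : D.weylIdeal ℓ ≤ LinearMap.ker (LinearMap.toSpanSingleton (U 𝔤) V v) := fun y hy => by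
    simpa using D.smul_eq_zero_of_mem_weylIdeal (fun y hy => D.rel_smul_eq_zero hv hn hy) hy
  have hgen : (D.weylIdeal ℓ).liftQ _ hle (D.weylGen ℓ) = v := by simp [weylGen]
  exact ⟨ℓ, rfl, _, surjective_of_span_eq_top _ hgen hspan, hgen⟩

end ChevalleyData

end Main

end LoopWeyl

end

open LoopWeyl in
theorem proposition2p1 {𝔤 : Type*} [LieRing 𝔤] [LieAlgebra ℂ 𝔤] [FiniteDimensional ℂ 𝔤]
    [LieAlgebra.IsSimple ℂ 𝔤] (𝔥 : LieSubalgebra ℂ 𝔤) [𝔥.IsCartanSubalgebra]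
    (D : ChevalleyData 𝔥) :
    -- (i) integrable highest weight modules are quotients of `W(λ)`
    (∀ (V : Type*) [AddCommGroup V] [Module ℂ V] [Module (Ue 𝔤) V] [IsScalarTower ℂ (Ue 𝔤) V]
      (lam : Module.Dual ℂ 𝔥) (a : ℂ) (v : V),
      D.IsIntegrable V → v ∈ D.highestWeightVectorsExt V lam a → v ≠ 0 →
      Submodule.span (Ue 𝔤) {v} = ⊤ →
      ∃ ℓ : D.I → ℕ, lam = D.domWeight ℓ ∧
        ∃ φ : D.WeylExt ℓ a →ₗ[Ue 𝔤] V, Function.Surjective φ ∧ φ (D.weylExtGen ℓ a) = v) ∧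
    -- (ii) finite-dimensional quotients of `W(λ)` with one-dimensional `λ`-weight space
    (∀ (V : Type*) [AddCommGroup V] [Module ℂ V] [Module (U 𝔤) V] [IsScalarTower ℂ (U 𝔤) V]
      [FiniteDimensional ℂ V] (ℓ : D.I → ℕ) (q : D.Weyl ℓ →ₗ[U 𝔤] V),
      Function.Surjective q → Module.finrank ℂ (weightSpace V (D.domWeight ℓ)) = 1 →
      ∃ p : D.I → Polynomial ℂ, (∀ i, (p i).coeff 0 = 1) ∧
        ∃ φ : D.WeylPi p →ₗ[U 𝔤] V,
          Function.Surjective φ ∧ φ (D.weylPiGen p) = q (D.weylGen ℓ)) ∧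
    -- (iii) finite-dimensional highest weight modules with one-dimensional `λ`-weight space
    (∀ (V : Type*) [AddCommGroup V] [Module ℂ V] [Module (U 𝔤) V] [IsScalarTower ℂ (U 𝔤) V]
      [FiniteDimensional ℂ V] (lam : Module.Dual ℂ 𝔥) (v : V),
      v ∈ D.highestWeightVectors V lam → Submodule.span (U 𝔤) {v} = ⊤ →
      Module.finrank ℂ (weightSpace V lam) = 1 →
      ∃ p : D.I → Polynomial ℂ, (∀ i, (p i).coeff 0 = 1) ∧
        ∃ φ : D.WeylPi p →ₗ[U 𝔤] V, Function.Surjective φ ∧ φ (D.weylPiGen p) = v) := by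
  refine ⟨fun V _ _ _ _ lam a v hV hv h0 hspan => D.exists_weylExt_hom hV hv h0 hspan,
    fun V _ _ _ _ _ ℓ q hq hdim => D.exists_weylPi_hom q hq hdim,
    fun V _ _ _ _ _ lam v hv hspan hdim => ?_⟩
  -- If `v` were zero, the module it generates would be zero and could not have a one-dimensional
  -- weight space.
  have h0 : v ≠ 0 := by
    rintro rfl
    rw [Submodule.span_zero_singleton] at hspan
    have : Subsingleton V := (Submodule.subsingleton_iff (U 𝔤)).mp (subsingleton_of_bot_eq_top hspan)
    rw [Module.finrank_zero_of_subsingleton] at hdim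
    exact zero_ne_one hdim
  obtain ⟨ℓ, rfl, q, hq, rfl⟩ := D.exists_weyl_hom hv hspan h0
  exact D.exists_weylPi_hom q hq hdim
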